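/- Let $\mathcal X,\mathcal Y$ be finite alphabets, let $W(y|x)$ be the transition probabilities of a discrete memoryless channel from $\mathcal X$ to $\mathcal Y$, and let $c:\mathcal X\to[0,\infty)$ be an input cost. Write $\mathcal P(\mathcal X)$ for the set of probability distributions on $\mathcal X$ and $\mathcal P(\mathcal Y|\mathcal X)$ for the set of conditional distributions on $\mathcal Y$ given $x\in\mathcal X$; logarithms are natural. For $R,\Gamma\ge 0$ define Csiszár and Körner's error exponent $$E_{\rm CK}(R,\Gamma|W)=\max_{\substack{q_X\in\mathcal P(\mathcal X):\\ \sum_x q_X(x)c(x)\le\Gamma}}\ \min_{q_{Y|X}\in\mathcal P(\mathcal Y|\mathcal X)}\Bigl\{D(q_{Y|X}\|W|q_X)+\bigl|I(q_X,q_{Y|X})-R\bigr|^+\Bigr\},$$ where $|a|^+=\max(a,0)$, $D(q_{Y|X}\|W|q_X)=\sum_x q_X(x)\sum_y q_{Y|X}(y|x)\log\frac{q_{Y|X}(y|x)}{W(y|x)}$ (with $0\log\frac00=0\log\frac0p=0$, $p\log\frac p0=+\infty$ for $p>0$, and $0\cdot\infty=0$), and $I(q_X,q_{Y|X})=\sum_{x,y}q_X(x)q_{Y|X}(y|x)\log\frac{q_{Y|X}(y|x)}{\sum_{x'}q_X(x')q_{Y|X}(y|x')}$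 is the mutual information. Define Gallager's random coding error exponent $$E_{\rm r}(R,\Gamma|W)=\max_{\rho\in[0,1]}\ \inf_{\nu\ge0}\ \max_{p_X\in\mathcal P(\mathcal X)}\bigl\{-\rho R+\rho\nu\Gamma+E_0^{(\rho,\nu)}(p_X|W)\bigr\},$$ $$E_0^{(\rho,\nu)}(p_X|W)=-\log\sum_{y}\Bigl[\sum_{x}p_X(x)\bigl\{W(y|x)e^{\rho\nu c(x)}\bigr\}^{\frac1{1+\rho}}\Bigr]^{1+\rho}.$$ Then for every $W$ and $c$ as above, every $R\ge0$ and every $\Gamma\ge0$ with $\Gamma\ge\Gamma_{\min}:=\min_{x}c(x)$, the maxima and the minimum in these definitions are attained, and $$E_{\rm CK}(R,\Gamma|W)=E_{\rm r}(R,\Gamma|W).$$ -/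

import Mathlib

noncomputable section

namespace ChannelExponent

/-- Conditional probability distributions of an output in `Y` given an input in `X`:
`V x y` is the probability of `y` given `x`. -/
def channels (X Y : Type*) [Fintype Y] : Set (X → Y → ℝ) :=
  {V | ∀ x, V x ∈ stdSimplex ℝ Y}

/-- Input distributions whose expected cost is at most `Γ`. -/
def costConstrained {X : Type*} [Fintype X] (c : X → ℝ) (Γ : ℝ) : Set (X → ℝ) :=
  {q | q ∈ stdSimplex ℝ X ∧ ∑ x, q x * c x ≤ Γ}

/-- The term `p log (p / w)` of a relative entropy (natural logarithm), with the conventions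
`0 log (0 / 0) = 0`, `0 log (0 / w) = 0` and `p log (p / 0) = +∞` for `p > 0`. -/
def klTerm (p w : ℝ) : EReal :=
  if p = 0 then 0 else if w = 0 then ⊤ else ((p * Real.log (p / w) : ℝ) : EReal)

/-- Conditional relative entropy `D(V ‖ W | q)`. In `EReal`, `0 * ⊤ = 0`, so inputs of
probability zero do not contribute. -/
def condRelEntropy {X Y : Type*} [Fintype X] [Fintype Y]
    (V W : X → Y → ℝ) (q : X → ℝ) : EReal :=
  ∑ x, (q x : EReal) * ∑ y, klTerm (V x y) (W x y)

/-- Output distribution of the channel `V` under the input distribution `q`. -/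
def outputDist {X Y : Type*} [Fintype X] (q : X → ℝ) (V : X → Y → ℝ) (y : Y) : ℝ :=
  ∑ x, q x * V x y

/-- Mutual information `I(q, V)`, in nats. A term with `q x * V x y ≠ 0` has a nonzero
denominator; all other terms vanish. -/
def mutualInfo {X Y : Type*} [Fintype X] [Fintype Y] (q : X → ℝ) (V : X → Y → ℝ) : ℝ :=
  ∑ x, ∑ y, q x * V x y * Real.log (V x y / outputDist q V y)

/-- The functional `D(V ‖ W | q) + |I(q, V) - R|⁺`. -/
def ckObjective {X Y : Type*} [Fintype X] [Fintype Y]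
    (W : X → Y → ℝ) (R : ℝ) (q : X → ℝ) (V : X → Y → ℝ) : EReal :=
  condRelEntropy V W q + ((max (mutualInfo q V - R) 0 : ℝ) : EReal)

/-- The minimum of the functional over all channels `V`, for a fixed input distribution. -/
def ckInner {X Y : Type*} [Fintype X] [Fintype Y]
    (W : X → Y → ℝ) (R : ℝ) (q : X → ℝ) : EReal :=
  ⨅ V ∈ channels X Y, ckObjective W R q V

/-- Csiszár and Körner's error exponent `E_CK(R, Γ | W)`. -/
def csiszarKornerExponent {X Y : Type*} [Fintype X] [Fintype Y]
    (W : X → Y → ℝ) (c : X → ℝ) (R Γ : ℝ) : EReal :=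
  ⨆ q ∈ costConstrained c Γ, ckInner W R q

/-- Gallager's function `E_0` for a channel with an input cost. -/
def gallagerE0 {X Y : Type*} [Fintype X] [Fintype Y]
    (W : X → Y → ℝ) (c : X → ℝ) (ρ ν : ℝ) (p : X → ℝ) : ℝ :=
  -Real.log (∑ y, (∑ x, p x * (W x y * Real.exp (ρ * ν * c x)) ^ (1 / (1 + ρ))) ^ (1 + ρ))

/-- The functional `-ρ R + ρ ν Γ + E_0(p)`. -/
def gallagerObjective {X Y : Type*} [Fintype X] [Fintype Y]
    (W : X → Y → ℝ) (c : X → ℝ) (R Γ ρ ν : ℝ) (p : X → ℝ) : ℝ :=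
  -ρ * R + ρ * ν * Γ + gallagerE0 W c ρ ν p

/-- The infimum over `ν ≥ 0` of the maximum over `p` of the functional, for a fixed `ρ`. -/
def gallagerInner {X Y : Type*} [Fintype X] [Fintype Y]
    (W : X → Y → ℝ) (c : X → ℝ) (R Γ ρ : ℝ) : EReal :=
  ⨅ ν ∈ Set.Ici (0 : ℝ), ⨆ p ∈ stdSimplex ℝ X, (gallagerObjective W c R Γ ρ ν p : EReal)

/-- Gallager's random coding error exponent `E_r(R, Γ | W)`. -/
def gallagerExponent {X Y : Type*} [Fintype X] [Fintype Y]
    (W : X → Y → ℝ) (c : X → ℝ) (R Γ : ℝ) : EReal :=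
  ⨆ ρ ∈ Set.Icc (0 : ℝ) 1, gallagerInner W c R Γ ρ

end ChannelExponent

end

namespace ChannelExponent

open Filter Topology

/-! Both exponents are iterated suprema, in opposite orders, of one function of `(ρ, q)`, namely
`tiltedExponent`.

Csiszár–Körner side. Since `|t|⁺` is the maximum of `ρ t` over `ρ ∈ [0, 1]`, and relative entropy
and mutual information are convex in the channel, Sion's theorem moves `ρ` outside the minimum over
channels (`ckInner_eq_iSup_iInf`). Mutual information is itself the infimum of `D(V ‖ Q | q)` over
output distributions `Q`. For fixed `Q` the minimum over `V` splits by input letter and has the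
closed form `tiltedCost`, a log-sum over the weighted geometric mean of `W(·|x)` and `Q`
(`iInf_dominatedChannels_eq`). What remains is an infimum over `Q` of functions affine in `q`.

Gallager side. For `ρ > 0` the cost constraint is replaced by a multiplier `ν ≥ 0`. The Lagrangian
is affine in `q` and jointly convex in `(ν, Q)`, so Sion's theorem applies again
(`gallagerInner_eq_iSup`). For fixed `ν` it must be shown that the infimum over `Q` of the worst
letter equals the maximum of Gallager's functional over `p` (`iSup_gallagerObjective_eq`). One
inequality is Hölder's; the other takes `Q` to be the Hölder equality case at an optimal `p` and
uses the first-order optimality condition there.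

Output distributions `Q` are kept strictly positive so that all logarithms are genuine; mixing with
the uniform distribution costs only `-ρ log (1 - ε)`, which vanishes in the limit. Attainment of the
outer maxima follows because `tiltedExponent` is upper semicontinuous on a compact set of pairs. -/

/-- A minimax theorem for real-valued functions with compactness on the side of the supremum. -/
theorem iSup_iInf_eq_iInf_iSup_of_isCompact {E F : Type*}
    [TopologicalSpace E] [AddCommGroup E] [Module ℝ E] [IsTopologicalAddGroup E]
    [ContinuousSMul ℝ E] [TopologicalSpace F] [AddCommGroup F] [Module ℝ F]
    [IsTopologicalAddGroup F] [ContinuousSMul ℝ F] {A : Set E} {B : Set F} {f : E → F → ℝ}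
    (hA : A.Nonempty) (cA : Convex ℝ A) (kA : IsCompact A) (cB : Convex ℝ B)
    (hfA : ∀ b ∈ B, ContinuousOn (fun a => f a b) A) (hfA' : ∀ b ∈ B, ConcaveOn ℝ A fun a => f a b)
    (hfB : ∀ a ∈ A, ContinuousOn (f a) B) (hfB' : ∀ a ∈ A, ConvexOn ℝ B (f a)) :
    (⨆ a ∈ A, ⨅ b ∈ B, (f a b : EReal)) = ⨅ b ∈ B, ⨆ a ∈ A, (f a b : EReal) := by
  have hm : Monotone ((↑) : ℝ → EReal) := EReal.coe_strictMono.monotone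
  have hl : ∀ b ∈ B, UpperSemicontinuousOn (fun a => (f a b : EReal)) A := fun b hb =>
    (continuous_coe_real_ereal.comp_continuousOn (hfA b hb)).upperSemicontinuousOn
  have hu : ∀ a ∈ A, LowerSemicontinuousOn (fun b => (f a b : EReal)) B := fun a ha =>
    (continuous_coe_real_ereal.comp_continuousOn (hfB a ha)).lowerSemicontinuousOn
  have hl' : ∀ b ∈ B, QuasiconcaveOn ℝ A (fun a => (f a b : EReal)) := fun b hb =>
    QuasiconcaveOn.monotone_comp (g := Real.toEReal) hm (hfA' b hb).quasiconcaveOn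
  have hu' : ∀ a ∈ A, QuasiconvexOn ℝ B (fun b => (f a b : EReal)) := fun a ha =>
    QuasiconvexOn.monotone_comp (g := Real.toEReal) hm (hfB' a ha).quasiconvexOn
  -- Reversing the order moves the compactness from the infimum side to the supremum side.
  exact Sion.minimax' (β := ERealᵒᵈ) (f := fun a b => OrderDual.toDual (f a b : EReal))
    hA cA kA hl hl' cB hu hu'

/-! ### Scalar convexity and Gibbs' inequality -/

/-- The tangent inequality for `a log (a / b)`. -/
theorem tangent_le_mul_log_div {a b s t : ℝ} (ha : 0 ≤ a) (hb : 0 ≤ b) (hab : b = 0 → a = 0)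
    (hs : 0 < s) (ht : 0 < t) :
    a * Real.log (s / t) + a - b * (s / t) ≤ a * Real.log (a / b) := by
  rcases ha.eq_or_lt with rfl | ha
  · simp only [zero_mul, zero_add, zero_sub, zero_div]
    have : 0 ≤ b * (s / t) := by positivity
    linarith
  · have hb : 0 < b := hb.lt_of_ne fun h => ha.ne' (hab h.symm)
    have h := Real.one_sub_inv_le_log_of_pos (x := (a / b) / (s / t)) (by positivity)
    rw [Real.log_div (by positivity) (by positivity)] at h
    have h2 := mul_le_mul_of_nonneg_left h ha.le
    have h3 : a * ((a / b) / (s / t))⁻¹ = b * (s / t) := by field_simp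
    rw [mul_sub, h3] at h2
    linarith

/-- Joint convexity of `a log (a / b)`. -/
theorem mul_log_div_convex {a₁ a₂ b₁ b₂ u v : ℝ} (ha₁ : 0 ≤ a₁) (ha₂ : 0 ≤ a₂)
    (hb₁ : 0 ≤ b₁) (hb₂ : 0 ≤ b₂) (h₁ : b₁ = 0 → a₁ = 0) (h₂ : b₂ = 0 → a₂ = 0)
    (hu : 0 ≤ u) (hv : 0 ≤ v) :
    (u * a₁ + v * a₂) * Real.log ((u * a₁ + v * a₂) / (u * b₁ + v * b₂)) ≤
      u * (a₁ * Real.log (a₁ / b₁)) + v * (a₂ * Real.log (a₂ / b₂)) := by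
  have hua : 0 ≤ u * a₁ := by positivity
  have hva : 0 ≤ v * a₂ := by positivity
  have hub : 0 ≤ u * b₁ := by positivity
  have hvb : 0 ≤ v * b₂ := by positivity
  rcases (add_nonneg hua hva).eq_or_lt with h | h
  · have e₁ : u * a₁ = 0 := by linarith
    have e₂ : v * a₂ = 0 := by linarith
    rw [← mul_assoc, ← mul_assoc, e₁, e₂]
    simp
  · have hb : 0 < u * b₁ + v * b₂ := by
      refine (add_nonneg hub hvb).lt_of_ne fun h0 => h.ne ?_
      have e₁ : u * b₁ = 0 := by linarith
      have e₂ : v * b₂ = 0 := by linarith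
      have f₁ : u * a₁ = 0 := by
        rcases mul_eq_zero.1 e₁ with e | e
        · simp [e]
        · simp [h₁ e]
      have f₂ : v * a₂ = 0 := by
        rcases mul_eq_zero.1 e₂ with e | e
        · simp [e]
        · simp [h₂ e]
      rw [f₁, f₂, add_zero]
    -- Both endpoints are compared with the same tangent, taken at the mixed point; the linear
    -- corrections then cancel.
    have t₁ := mul_le_mul_of_nonneg_left (tangent_le_mul_log_div ha₁ hb₁ h₁ h hb) hu
    have t₂ := mul_le_mul_of_nonneg_left (tangent_le_mul_log_div ha₂ hb₂ h₂ h hb) hv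
    have e : (u * b₁ + v * b₂) * ((u * a₁ + v * a₂) / (u * b₁ + v * b₂)) = u * a₁ + v * a₂ := by
      field_simp
    nlinarith [t₁, t₂, e]

/-- Gibbs' inequality against an unnormalized positive weight. -/
theorem neg_log_sum_le_sum_mul_log_div {Y : Type*} [Fintype Y] {v g : Y → ℝ}
    (hv : v ∈ stdSimplex ℝ Y) (hg : ∀ y, 0 ≤ g y) (hvg : ∀ y, g y = 0 → v y = 0) :
    -Real.log (∑ y, g y) ≤ ∑ y, v y * Real.log (v y / g y) := by
  have hZ : 0 < ∑ y, g y := by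
    refine (Finset.sum_nonneg fun y _ => hg y).lt_of_ne fun h => ?_
    have h0 := (Finset.sum_eq_zero_iff_of_nonneg fun y _ => hg y).1 h.symm
    have : ∑ y, v y = 0 := Finset.sum_eq_zero fun y hy => hvg y (h0 y hy)
    rw [hv.2] at this
    exact one_ne_zero this
  calc -Real.log (∑ y, g y)
      = ∑ y, (v y * Real.log (1 / ∑ y, g y) + v y - g y * (1 / ∑ y, g y)) := by
        rw [Finset.sum_sub_distrib, Finset.sum_add_distrib, ← Finset.sum_mul, ← Finset.sum_mul,
          hv.2, one_div, Real.log_inv, mul_inv_cancel₀ hZ.ne']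
        ring
    _ ≤ _ := Finset.sum_le_sum fun y _ =>
        tangent_le_mul_log_div (hv.1 y) (hg y) (hvg y) one_pos hZ

/-- A bound that holds up to `-t log (1 - ε)` for every `ε ∈ (0, 1)` holds exactly. -/
theorem le_coe_of_forall_le_sub_mul_log {a : EReal} {r t : ℝ}
    (h : ∀ ε ∈ Set.Ioo (0 : ℝ) 1, a ≤ ((r - t * Real.log (1 - ε) : ℝ) : EReal)) :
    a ≤ (r : EReal) := by
  have hc : ContinuousAt (fun ε : ℝ => ((r - t * Real.log (1 - ε) : ℝ) : EReal)) 0 := by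
    refine continuous_coe_real_ereal.continuousAt.comp ?_
    have : ContinuousAt (fun ε : ℝ => Real.log (1 - ε)) 0 :=
      ContinuousAt.log (by fun_prop) (by norm_num)
    fun_prop
  have ht : Tendsto (fun ε : ℝ => ((r - t * Real.log (1 - ε) : ℝ) : EReal)) (𝓝[>] 0) (𝓝 r) := by
    have := hc.tendsto.mono_left (nhdsWithin_le_nhds (s := Set.Ioi 0))
    simpa using this
  exact ge_of_tendsto ht (by
    filter_upwards [Ioo_mem_nhdsGT (show (0 : ℝ) < 1 by norm_num)] with ε hε using h ε hε)

/-! ### Relative entropy and mutual information as functions of the channel -/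

/-- Real-valued version of the conditional relative entropy. -/
noncomputable def relEntropyReal {X Y : Type*} [Fintype X] [Fintype Y] (V W : X → Y → ℝ) (q : X → ℝ) : ℝ :=
  ∑ x, q x * ∑ y, V x y * Real.log (V x y / W x y)

/-- The channels at finite conditional relative entropy from `W`. -/
def dominatedChannels {X Y : Type*} [Fintype Y] (W : X → Y → ℝ) (q : X → ℝ) :
    Set (X → Y → ℝ) :=
  {V | V ∈ channels X Y ∧ ∀ x y, q x ≠ 0 → W x y = 0 → V x y = 0}

section

variable {X Y : Type*} [Fintype Y] {W : X → Y → ℝ} {q : X → ℝ}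

theorem mem_channels_nonneg {V : X → Y → ℝ} (hV : V ∈ channels X Y) (x : X) (y : Y) :
    0 ≤ V x y := (hV x).1 y

theorem convex_channels : Convex ℝ (channels X Y) := by
  intro V₁ h₁ V₂ h₂ a b ha hb hab x
  exact convex_stdSimplex ℝ Y (h₁ x) (h₂ x) ha hb hab

theorem isCompact_channels : IsCompact (channels X Y) := by
  have : channels X Y = Set.univ.pi fun _ => stdSimplex ℝ Y := by
    ext V; simp [channels]
  rw [this]
  exact isCompact_univ_pi fun _ => isCompact_stdSimplex ℝ Y

theorem convex_dominatedChannels : Convex ℝ (dominatedChannels W q) := by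
  intro V₁ h₁ V₂ h₂ a b ha hb hab
  refine ⟨convex_channels h₁.1 h₂.1 ha hb hab, fun x y hx hw => ?_⟩
  simp [h₁.2 x y hx hw, h₂.2 x y hx hw]

theorem isCompact_dominatedChannels : IsCompact (dominatedChannels W q) := by
  have : dominatedChannels W q =
      channels X Y ∩ {V | ∀ x y, q x ≠ 0 → W x y = 0 → V x y = 0} := rfl
  rw [this]
  refine isCompact_channels.inter_right ?_
  simp only [Set.ofPred_forall]
  refine isClosed_iInter fun x => isClosed_iInter fun y => isClosed_iInter fun _ =>
    isClosed_iInter fun _ => isClosed_eq (by fun_prop) (by fun_prop)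

theorem self_mem_dominatedChannels (hW : W ∈ channels X Y) : W ∈ dominatedChannels W q :=
  ⟨hW, fun _ _ _ h => h⟩

end

theorem coe_sum_ereal {ι : Type*} (s : Finset ι) (f : ι → ℝ) :
    ((∑ i ∈ s, f i : ℝ) : EReal) = ∑ i ∈ s, (f i : EReal) :=
  map_sum (⟨⟨(↑), EReal.coe_zero⟩, EReal.coe_add⟩ : ℝ →+ EReal) f s

theorem sum_eq_top_of_exists {ι : Type*} {s : Finset ι} {f : ι → EReal} {i : ι} (hi : i ∈ s)
    (hf : f i = ⊤) (hb : ∀ j ∈ s, f j ≠ ⊥) : ∑ j ∈ s, f j = ⊤ := by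
  classical
  have key : ∀ t ⊆ s, ∑ j ∈ t, f j ≠ ⊥ := by
    intro t
    induction t using Finset.induction_on with
    | empty => intro _; simp
    | insert a t ha ih =>
      intro h
      rw [Finset.sum_insert ha, EReal.add_ne_bot_iff]
      exact ⟨hb a (h (Finset.mem_insert_self _ _)),
        ih fun x hx => h (Finset.mem_insert_of_mem hx)⟩
  rw [← Finset.add_sum_erase s f hi, hf]
  exact EReal.top_add_of_ne_bot (key _ (Finset.erase_subset _ _))

theorem klTerm_ne_bot (p w : ℝ) : klTerm p w ≠ ⊥ := by
  unfold klTerm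
  split_ifs
  exacts [EReal.zero_ne_bot, top_ne_bot, EReal.coe_ne_bot _]

theorem klTerm_eq_coe {p w : ℝ} (h : w = 0 → p = 0) :
    klTerm p w = ((p * Real.log (p / w) : ℝ) : EReal) := by
  unfold klTerm
  split_ifs with hp hw
  · simp [hp]
  · exact absurd (h hw) hp
  · rfl

section

variable {X Y : Type*} [Fintype X] [Fintype Y] {W : X → Y → ℝ} {q : X → ℝ}

theorem condRelEntropy_eq_coe {V : X → Y → ℝ} (hV : V ∈ dominatedChannels W q) :
    condRelEntropy V W q = (relEntropyReal V W q : EReal) := by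
  rw [condRelEntropy, relEntropyReal, coe_sum_ereal]
  refine Finset.sum_congr rfl fun x _ => ?_
  rw [EReal.coe_mul, coe_sum_ereal]
  by_cases hx : q x = 0
  · simp [hx]
  · congr 1
    exact Finset.sum_congr rfl fun y _ => klTerm_eq_coe (hV.2 x y hx)

theorem condRelEntropy_eq_top {V : X → Y → ℝ} (hq : ∀ x, 0 ≤ q x) (hV : V ∈ channels X Y)
    (h : V ∉ dominatedChannels W q) : condRelEntropy V W q = ⊤ := by
  have hex : ∃ x y, q x ≠ 0 ∧ W x y = 0 ∧ V x y ≠ 0 := by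
    by_contra hne
    push Not at hne
    exact h ⟨hV, hne⟩
  obtain ⟨x, y, hx, hw, hv⟩ := hex
  have hsum : ∑ y, klTerm (V x y) (W x y) = ⊤ :=
    sum_eq_top_of_exists (Finset.mem_univ y) (by simp [klTerm, hw, hv])
      fun _ _ => klTerm_ne_bot _ _
  -- In `EReal` a summand `⊥` would override `⊤`, so it has to be excluded in every row.
  have hnb : ∀ x', ∑ y, klTerm (V x' y) (W x' y) ≠ ⊥ := fun x' => by
    by_cases h' : ∃ y, klTerm (V x' y) (W x' y) = ⊤
    · obtain ⟨y', hy'⟩ := h'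
      rw [sum_eq_top_of_exists (Finset.mem_univ y') hy' fun _ _ => klTerm_ne_bot _ _]
      simp
    · push Not at h'
      rw [show ∑ y, klTerm (V x' y) (W x' y) =
        ((∑ y, (klTerm (V x' y) (W x' y)).toReal : ℝ) : EReal) by
          rw [coe_sum_ereal]
          exact Finset.sum_congr rfl fun y _ =>
            (EReal.coe_toReal (h' y) (klTerm_ne_bot _ _)).symm]
      exact EReal.coe_ne_bot _
  refine sum_eq_top_of_exists (Finset.mem_univ x) ?_ fun x' _ => ?_
  · rw [hsum, EReal.coe_mul_top_of_pos ((hq x).lt_of_ne hx.symm)]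
  · rcases (hq x').eq_or_lt with h0 | h0
    · simp [← h0]
    · intro hb
      rw [EReal.mul_eq_bot] at hb
      have := hnb x'
      have h1 : ¬ (q x' < 0) := not_lt.2 h0.le
      simp_all

theorem continuous_mul_log_div (w : ℝ) : Continuous fun v : ℝ => v * Real.log (v / w) := by
  by_cases hw : w = 0
  -- Division by zero and `log 0` both return zero, so the function is constant here.
  · simp [hw, continuous_const]
  · have : (fun v : ℝ => v * Real.log (v / w)) = fun v => w * (v / w * Real.log (v / w)) := by
      ext v; field_simp
    rw [this]
    exact continuous_const.mul (Real.continuous_mul_log.comp (by fun_prop))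

theorem continuous_relEntropyReal : Continuous fun V : X → Y → ℝ => relEntropyReal V W q := by
  unfold relEntropyReal
  refine continuous_finsetSum _ fun x _ => continuous_const.mul <| continuous_finsetSum _ fun y _ =>
    (continuous_mul_log_div (W x y)).comp (by fun_prop)

theorem outputDist_nonneg {V : X → Y → ℝ} (hq : ∀ x, 0 ≤ q x) (hV : V ∈ channels X Y) (y : Y) :
    0 ≤ outputDist q V y :=
  Finset.sum_nonneg fun x _ => mul_nonneg (hq x) (mem_channels_nonneg hV x y)

theorem eq_zero_of_outputDist_eq_zero {V : X → Y → ℝ} (hq : ∀ x, 0 ≤ q x)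
    (hV : V ∈ channels X Y) {x : X} {y : Y} (hx : q x ≠ 0) (h : outputDist q V y = 0) :
    V x y = 0 := by
  have := (Finset.sum_eq_zero_iff_of_nonneg
    fun x _ => mul_nonneg (hq x) (mem_channels_nonneg hV x y)).1 h x (Finset.mem_univ x)
  exact (mul_eq_zero.1 this).resolve_left hx

theorem outputDist_mem_stdSimplex {V : X → Y → ℝ} (hq : q ∈ stdSimplex ℝ X)
    (hV : V ∈ channels X Y) : outputDist q V ∈ stdSimplex ℝ Y := by
  refine ⟨outputDist_nonneg hq.1 hV, ?_⟩
  unfold outputDist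
  rw [Finset.sum_comm]
  simp_rw [← Finset.mul_sum, (hV _).2, mul_one]
  exact hq.2

/-- As a difference of entropies, mutual information involves only `t log t`, which is continuous at
zero; the quotient form hides this where an output probability vanishes. -/
theorem mutualInfo_eq_sub {V : X → Y → ℝ} (hq : ∀ x, 0 ≤ q x) (hV : V ∈ channels X Y) :
    mutualInfo q V = (∑ x, ∑ y, q x * (V x y * Real.log (V x y))) -
      ∑ y, outputDist q V y * Real.log (outputDist q V y) := by
  have : ∑ y, outputDist q V y * Real.log (outputDist q V y) =
      ∑ x, ∑ y, q x * V x y * Real.log (outputDist q V y) := by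
    rw [Finset.sum_comm]
    refine Finset.sum_congr rfl fun y _ => ?_
    rw [← Finset.sum_mul]
    rfl
  rw [this, ← Finset.sum_sub_distrib]
  refine Finset.sum_congr rfl fun x _ => ?_
  rw [← Finset.sum_sub_distrib]
  refine Finset.sum_congr rfl fun y _ => ?_
  by_cases hx : q x = 0
  · simp [hx]
  by_cases hv : V x y = 0
  · simp [hv]
  rw [Real.log_div hv fun h => hv (eq_zero_of_outputDist_eq_zero hq hV hx h)]
  ring

theorem continuousOn_mutualInfo (hq : ∀ x, 0 ≤ q x) :
    ContinuousOn (fun V : X → Y → ℝ => mutualInfo q V) (channels X Y) := by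
  have hc : Continuous fun V : X → Y → ℝ => (∑ x, ∑ y, q x * (V x y * Real.log (V x y))) -
      ∑ y, outputDist q V y * Real.log (outputDist q V y) := by
    refine Continuous.sub ?_ ?_
    · exact continuous_finsetSum _ fun x _ => continuous_finsetSum _ fun y _ =>
        continuous_const.mul (Real.continuous_mul_log.comp (by fun_prop))
    · refine continuous_finsetSum _ fun y _ => Real.continuous_mul_log.comp ?_
      unfold outputDist
      fun_prop
  exact hc.continuousOn.congr fun V hV => mutualInfo_eq_sub hq hV

theorem convexOn_relEntropyReal (hq : ∀ x, 0 ≤ q x) (hW : W ∈ channels X Y) :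
    ConvexOn ℝ (dominatedChannels W q) fun V => relEntropyReal V W q := by
  refine ⟨convex_dominatedChannels, fun V₁ h₁ V₂ h₂ a b ha hb hab => ?_⟩
  simp only [relEntropyReal, smul_eq_mul, Finset.mul_sum]
  rw [← Finset.sum_add_distrib]
  refine Finset.sum_le_sum fun x _ => ?_
  rw [← Finset.sum_add_distrib]
  refine Finset.sum_le_sum fun y _ => ?_
  by_cases hx : q x = 0
  · simp [hx]
  have h := mul_log_div_convex (mem_channels_nonneg h₁.1 x y) (mem_channels_nonneg h₂.1 x y)
    (mem_channels_nonneg hW x y) (mem_channels_nonneg hW x y) (h₁.2 x y hx) (h₂.2 x y hx) ha hb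
  rw [← add_mul, hab, one_mul] at h
  have := mul_le_mul_of_nonneg_left h (hq x)
  simp only [Pi.add_apply, Pi.smul_apply, smul_eq_mul]
  linarith

/-- The output distribution is linear in the channel, so joint convexity of `a log (a / b)` applies
term by term. -/
theorem convexOn_mutualInfo (hq : ∀ x, 0 ≤ q x) :
    ConvexOn ℝ (channels X Y) fun V => mutualInfo q V := by
  refine ⟨convex_channels, fun V₁ h₁ V₂ h₂ a b ha hb hab => ?_⟩
  simp only [mutualInfo, smul_eq_mul, Finset.mul_sum]
  rw [← Finset.sum_add_distrib]
  refine Finset.sum_le_sum fun x _ => ?_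
  rw [← Finset.sum_add_distrib]
  refine Finset.sum_le_sum fun y _ => ?_
  by_cases hx : q x = 0
  · simp [hx]
  have h := mul_log_div_convex (mem_channels_nonneg h₁ x y) (mem_channels_nonneg h₂ x y)
    (outputDist_nonneg hq h₁ y) (outputDist_nonneg hq h₂ y)
    (eq_zero_of_outputDist_eq_zero hq h₁ hx) (eq_zero_of_outputDist_eq_zero hq h₂ hx) ha hb
  have ho : outputDist q (a • V₁ + b • V₂) y = a * outputDist q V₁ y + b * outputDist q V₂ y := by
    simp only [outputDist, Finset.mul_sum, ← Finset.sum_add_distrib, Pi.add_apply, Pi.smul_apply,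
      smul_eq_mul]
    exact Finset.sum_congr rfl fun _ _ => by ring
  have := mul_le_mul_of_nonneg_left h (hq x)
  rw [ho]
  simp only [Pi.add_apply, Pi.smul_apply, smul_eq_mul]
  linarith

/-- The functional is finite on the dominated channels. -/
theorem ckObjective_eq_coe {R : ℝ} {V : X → Y → ℝ} (hV : V ∈ dominatedChannels W q) :
    ckObjective W R q V =
      ((relEntropyReal V W q + max (mutualInfo q V - R) 0 : ℝ) : EReal) := by
  rw [ckObjective, condRelEntropy_eq_coe hV, EReal.coe_add]

theorem ckObjective_eq_top {R : ℝ} {V : X → Y → ℝ} (hq : ∀ x, 0 ≤ q x) (hV : V ∈ channels X Y)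
    (h : V ∉ dominatedChannels W q) : ckObjective W R q V = ⊤ := by
  rw [ckObjective, condRelEntropy_eq_top hq hV h]
  exact EReal.top_add_coe _

/-- The functional is `⊤` off the dominated channels, which form a compact set containing `W` on
which it is real and continuous. -/
theorem exists_isMinOn_ckObjective (hW : W ∈ channels X Y) (R : ℝ) (hq : ∀ x, 0 ≤ q x) :
    ∃ V ∈ channels X Y, IsMinOn (ckObjective W R q) (channels X Y) V := by
  have hc : ContinuousOn (fun V => relEntropyReal V W q + max (mutualInfo q V - R) 0)
      (dominatedChannels W q) := by
    refine continuous_relEntropyReal.continuousOn.add ?_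
    have hI : ContinuousOn (fun V : X → Y → ℝ => mutualInfo q V) (dominatedChannels W q) :=
      (continuousOn_mutualInfo hq).mono fun V hV => hV.1
    exact (hI.sub continuousOn_const).sup continuousOn_const
  obtain ⟨V, hV, hmin⟩ := isCompact_dominatedChannels.exists_isMinOn
    ⟨W, self_mem_dominatedChannels hW⟩ hc
  refine ⟨V, hV.1, fun V' hV' => ?_⟩
  by_cases h : V' ∈ dominatedChannels W q
  · show ckObjective W R q V ≤ ckObjective W R q V'
    rw [ckObjective_eq_coe hV, ckObjective_eq_coe h]
    exact EReal.coe_le_coe_iff.2 (hmin h)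
  · show ckObjective W R q V ≤ ckObjective W R q V'
    rw [ckObjective_eq_top hq hV' h]
    exact le_top

/-- The positive part as a maximum over `ρ ∈ [0, 1]`. -/
theorem iSup_add_mul_eq (d t : ℝ) :
    (⨆ ρ ∈ Set.Icc (0 : ℝ) 1, ((d + ρ * t : ℝ) : EReal)) = ((d + max t 0 : ℝ) : EReal) := by
  refine le_antisymm (iSup₂_le fun ρ hρ => EReal.coe_le_coe_iff.2 ?_) ?_
  · rcases le_total t 0 with h | h
    · rw [max_eq_right h]
      linarith [mul_nonpos_of_nonneg_of_nonpos hρ.1 h]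
    · rw [max_eq_left h]
      linarith [mul_le_of_le_one_left h hρ.2]
  · rcases le_total t 0 with h | h
    · rw [max_eq_right h]
      exact le_iSup₂_of_le 0 (by simp) (by simp)
    · rw [max_eq_left h]
      exact le_iSup₂_of_le 1 (by simp) (by simp)

/-- Minimax exchange of the channel and of the parameter `ρ`. -/
theorem ckInner_eq_iSup_iInf (hW : W ∈ channels X Y) (R : ℝ) (hq : ∀ x, 0 ≤ q x) :
    ckInner W R q = ⨆ ρ ∈ Set.Icc (0 : ℝ) 1, ⨅ V ∈ dominatedChannels W q,
      ((relEntropyReal V W q + ρ * (mutualInfo q V - R) : ℝ) : EReal) := by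
  have hI : ContinuousOn (fun V : X → Y → ℝ => mutualInfo q V) (dominatedChannels W q) :=
    (continuousOn_mutualInfo hq).mono fun V hV => hV.1
  have hI' : ConvexOn ℝ (dominatedChannels W q) fun V => mutualInfo q V :=
    (convexOn_mutualInfo hq).subset (fun V hV => hV.1) convex_dominatedChannels
  rw [iSup_iInf_eq_iInf_iSup_of_isCompact (f := fun ρ V =>
    relEntropyReal V W q + ρ * (mutualInfo q V - R)) ⟨0, by simp⟩ (convex_Icc 0 1) isCompact_Icc
    convex_dominatedChannels]
  · refine le_antisymm (le_iInf₂ fun V hV => ?_) (le_iInf₂ fun V hV => ?_)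
    · rw [iSup_add_mul_eq, ← ckObjective_eq_coe hV]
      exact iInf₂_le V hV.1
    · by_cases h : V ∈ dominatedChannels W q
      · refine iInf₂_le_of_le V h ?_
        rw [iSup_add_mul_eq, ← ckObjective_eq_coe h]
      · rw [ckObjective_eq_top hq hV h]
        exact le_top
  · intro V _
    fun_prop
  · refine fun V _ => ⟨convex_Icc 0 1, fun r _ s _ a b _ _ hab => le_of_eq ?_⟩
    simp only [smul_eq_mul]
    linear_combination (relEntropyReal V W q) * hab
  · intro ρ _
    exact continuous_relEntropyReal.continuousOn.add
      (continuousOn_const.mul (hI.sub continuousOn_const))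
  · intro ρ hρ
    refine (convexOn_relEntropyReal hq hW).add ?_
    exact (hI'.sub (concaveOn_const R convex_dominatedChannels)).smul hρ.1

end

/-! ### Elimination of the channel in favour of an output distribution -/

/-- Strictly positive probability distributions. -/
def positiveSimplex (Y : Type*) [Fintype Y] : Set (Y → ℝ) :=
  {Q | Q ∈ stdSimplex ℝ Y ∧ ∀ y, 0 < Q y}

/-- The sum `∑ y, W(y|x)^(1/(1+ρ)) Q(y)^(ρ/(1+ρ))`. -/
noncomputable def tiltedSum {X Y : Type*} [Fintype Y] (W : X → Y → ℝ) (ρ : ℝ) (Q : Y → ℝ)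
    (x : X) : ℝ :=
  ∑ y, W x y ^ (1 / (1 + ρ)) * Q y ^ (ρ / (1 + ρ))

/-- The minimum of `D(v ‖ W(·|x)) + ρ D(v ‖ Q)` over output distributions `v`. -/
noncomputable def tiltedCost {X Y : Type*} [Fintype Y] (W : X → Y → ℝ) (ρ : ℝ) (Q : Y → ℝ)
    (x : X) : ℝ :=
  -(1 + ρ) * Real.log (tiltedSum W ρ Q x)

/-- The infimum of `-ρ R + D(V ‖ W | q) + ρ I(q, V)` over channels, as an infimum over output
distributions. -/
noncomputable def tiltedExponent {X Y : Type*} [Fintype X] [Fintype Y] (W : X → Y → ℝ) (R ρ : ℝ)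
    (q : X → ℝ) : EReal :=
  ⨅ Q ∈ positiveSimplex Y, ((-ρ * R + ∑ x, q x * tiltedCost W ρ Q x : ℝ) : EReal)

/-- The mixture of an output distribution with the uniform one. -/
noncomputable def mixUniform {Y : Type*} [Fintype Y] (ε : ℝ) (Q : Y → ℝ) (y : Y) : ℝ :=
  (1 - ε) * Q y + ε / Fintype.card Y

section

variable {X Y : Type*} [Fintype Y] {W : X → Y → ℝ} {Q : Y → ℝ} {ρ ε : ℝ}

theorem le_mixUniform (hε : ε ∈ Set.Ioo (0 : ℝ) 1) (y : Y) :
    (1 - ε) * Q y ≤ mixUniform ε Q y :=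
  le_add_of_nonneg_right (div_nonneg hε.1.le (Nat.cast_nonneg _))

theorem mixUniform_mem (hQ : Q ∈ stdSimplex ℝ Y) (hε : ε ∈ Set.Ioo (0 : ℝ) 1) :
    mixUniform ε Q ∈ positiveSimplex Y := by
  have hne : Nonempty Y := by
    by_contra h
    rw [not_nonempty_iff] at h
    simpa using hQ.2
  have hcard : (0 : ℝ) < Fintype.card Y := Nat.cast_pos.2 Fintype.card_pos
  have hpos : ∀ y, 0 < mixUniform ε Q y := fun y =>
    add_pos_of_nonneg_of_pos (mul_nonneg (by linarith [hε.2]) (hQ.1 y)) (div_pos hε.1 hcard)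
  refine ⟨⟨fun y => (hpos y).le, ?_⟩, hpos⟩
  simp only [mixUniform, Finset.sum_add_distrib, ← Finset.mul_sum, hQ.2, Finset.sum_const,
    Finset.card_univ, nsmul_eq_mul]
  field_simp
  ring

theorem tiltedSum_pos (hW : W ∈ channels X Y) (hQ : ∀ y, 0 < Q y) (x : X) :
    0 < tiltedSum W ρ Q x := by
  have hex : ∃ y, W x y ≠ 0 := by
    by_contra! h
    have := (hW x).2
    simp [h] at this
  obtain ⟨y, hy⟩ := hex
  have hy' : 0 < W x y := ((hW x).1 y).lt_of_ne hy.symm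
  refine Finset.sum_pos' (fun y _ => mul_nonneg (Real.rpow_nonneg ((hW x).1 y) _)
    (Real.rpow_nonneg (hQ y).le _)) ⟨y, Finset.mem_univ y, ?_⟩
  exact mul_pos (Real.rpow_pos_of_pos hy' _) (Real.rpow_pos_of_pos (hQ y) _)

/-- Two divergences with weights `1` and `ρ` merge into one divergence from the weighted geometric
mean; this is the source of the exponents in `tiltedSum`. -/
theorem mul_log_div_tilted {v w r : ℝ} (hw : 0 ≤ w) (hr : 0 < r)
    (hvw : w = 0 → v = 0) (hρ : 0 ≤ ρ) :
    (1 + ρ) * (v * Real.log (v / (w ^ (1 / (1 + ρ)) * r ^ (ρ / (1 + ρ))))) =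
      v * Real.log (v / w) + ρ * (v * Real.log (v / r)) := by
  by_cases h0 : v = 0
  · simp [h0]
  have hw' : 0 < w := hw.lt_of_ne fun h => h0 (hvw h.symm)
  have h1 : 1 + ρ ≠ 0 := by positivity
  rw [Real.log_div h0 (by positivity), Real.log_mul (by positivity) (by positivity),
    Real.log_rpow hw', Real.log_rpow hr, Real.log_div h0 hw'.ne', Real.log_div h0 hr.ne']
  field_simp
  ring

theorem tiltedCost_le {v : Y → ℝ} {x : X} (hW : ∀ y, 0 ≤ W x y) (hv : v ∈ stdSimplex ℝ Y)
    (hvw : ∀ y, W x y = 0 → v y = 0) (hQ : ∀ y, 0 < Q y) (hρ : 0 ≤ ρ) :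
    tiltedCost W ρ Q x ≤
      ∑ y, v y * Real.log (v y / W x y) + ρ * ∑ y, v y * Real.log (v y / Q y) := by
  have h := neg_log_sum_le_sum_mul_log_div
    (g := fun y => W x y ^ (1 / (1 + ρ)) * Q y ^ (ρ / (1 + ρ))) hv
    (fun y => mul_nonneg (Real.rpow_nonneg (hW y) _) (Real.rpow_nonneg (hQ y).le _)) fun y hy => by
      rcases mul_eq_zero.1 hy with h | h
      · exact hvw y ((Real.rpow_eq_zero (hW y) (by positivity)).1 h)
      · exact absurd h (Real.rpow_pos_of_pos (hQ y) _).ne'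
  have h2 := mul_le_mul_of_nonneg_left h (show 0 ≤ 1 + ρ by positivity)
  rw [Finset.mul_sum, Finset.sum_congr rfl fun y _ =>
    mul_log_div_tilted (hW y) (hQ y) (hvw y) hρ, Finset.sum_add_distrib,
    ← Finset.mul_sum] at h2
  unfold tiltedCost tiltedSum
  linarith

/-- The channel that attains the minimum defining `tiltedCost`. -/
noncomputable def tiltedChannel {X Y : Type*} [Fintype Y] (W : X → Y → ℝ) (ρ : ℝ) (Q : Y → ℝ)
    (x : X) (y : Y) : ℝ :=
  W x y ^ (1 / (1 + ρ)) * Q y ^ (ρ / (1 + ρ)) / tiltedSum W ρ Q x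

theorem tiltedChannel_mem (hW : W ∈ channels X Y) (hQ : ∀ y, 0 < Q y) :
    tiltedChannel W ρ Q ∈ channels X Y := fun x => by
  have hZ := tiltedSum_pos (ρ := ρ) hW hQ x
  refine ⟨fun y => div_nonneg (mul_nonneg (Real.rpow_nonneg ((hW x).1 y) _)
    (Real.rpow_nonneg (hQ y).le _)) hZ.le, ?_⟩
  simp only [tiltedChannel]
  rw [← Finset.sum_div]
  exact div_self hZ.ne'

theorem tiltedChannel_eq_zero {x : X} {y : Y} (hρ : 0 ≤ ρ) (h : W x y = 0) :
    tiltedChannel W ρ Q x y = 0 := by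
  have h1 : 1 / (1 + ρ) ≠ 0 := by positivity
  rw [tiltedChannel, h, Real.zero_rpow h1, zero_mul, zero_div]

/-- Equality case of Gibbs' inequality: the normalized weight differs from the weight by a constant
factor, so the logarithm is constant on the support. -/
theorem tiltedCost_eq (hW : W ∈ channels X Y) (hQ : ∀ y, 0 < Q y) (hρ : 0 ≤ ρ) (x : X) :
    ∑ y, tiltedChannel W ρ Q x y * Real.log (tiltedChannel W ρ Q x y / W x y) +
      ρ * ∑ y, tiltedChannel W ρ Q x y * Real.log (tiltedChannel W ρ Q x y / Q y) =
    tiltedCost W ρ Q x := by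
  have hZ := tiltedSum_pos (ρ := ρ) hW hQ x
  have hv := tiltedChannel_mem (ρ := ρ) hW hQ x
  rw [Finset.mul_sum, ← Finset.sum_add_distrib, Finset.sum_congr rfl fun y _ =>
    (mul_log_div_tilted ((hW x).1 y) (hQ y) (fun h => tiltedChannel_eq_zero hρ h)
      hρ).symm, ← Finset.mul_sum]
  have : ∀ y, tiltedChannel W ρ Q x y * Real.log (tiltedChannel W ρ Q x y /
      (W x y ^ (1 / (1 + ρ)) * Q y ^ (ρ / (1 + ρ)))) =
      tiltedChannel W ρ Q x y * -Real.log (tiltedSum W ρ Q x) := fun y => by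
    by_cases h : W x y ^ (1 / (1 + ρ)) * Q y ^ (ρ / (1 + ρ)) = 0
    · rw [tiltedChannel, h, zero_div, zero_mul, zero_mul]
    · rw [← Real.log_inv, tiltedChannel, div_div_cancel_left' h]
  rw [Finset.sum_congr rfl fun y _ => this y, ← Finset.sum_mul, hv.2, tiltedCost]
  ring

theorem continuousOn_tiltedCost (hW : W ∈ channels X Y) (hQ : ∀ y, 0 < Q y) (x : X) :
    ContinuousOn (fun ρ : ℝ => tiltedCost W ρ Q x) (Set.Icc 0 1) := by
  have h1 : ∀ ρ ∈ Set.Icc (0 : ℝ) 1, 1 + ρ ≠ 0 := fun ρ hρ => by linarith [hρ.1]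
  refine ContinuousOn.mul (by fun_prop) (ContinuousOn.log ?_ fun ρ _ => (tiltedSum_pos hW hQ x).ne')
  refine continuousOn_finsetSum _ fun y _ => ContinuousOn.mul ?_ ?_
  -- The base may be zero, but the exponent stays positive.
  · exact continuousOn_const.rpow (continuousOn_const.div (by fun_prop) h1)
      fun ρ hρ => Or.inr (one_div_pos.2 (by linarith [hρ.1]))
  · exact continuousOn_const.rpow (continuousOn_id.div (by fun_prop) h1)
      fun ρ _ => Or.inl (hQ y).ne'

end

section

variable {X Y : Type*} [Fintype X] [Fintype Y] {W : X → Y → ℝ} {q : X → ℝ}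

/-- The gap is the relative entropy of the output distribution from `Q`, which is nonnegative by
Gibbs. -/
theorem mutualInfo_le_sum {V : X → Y → ℝ} {Q : Y → ℝ} (hq : q ∈ stdSimplex ℝ X)
    (hV : V ∈ channels X Y) (hQ : Q ∈ positiveSimplex Y) :
    mutualInfo q V ≤ ∑ x, q x * ∑ y, V x y * Real.log (V x y / Q y) := by
  have ho := outputDist_mem_stdSimplex hq hV
  have h := neg_log_sum_le_sum_mul_log_div ho (fun y => (hQ.2 y).le)
    fun y hy => absurd hy (hQ.2 y).ne'
  rw [hQ.1.2, Real.log_one, neg_zero] at h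
  have e : ∑ y, outputDist q V y * Real.log (outputDist q V y / Q y) =
      ∑ x, ∑ y, q x * V x y * Real.log (outputDist q V y / Q y) := by
    rw [Finset.sum_comm]
    refine Finset.sum_congr rfl fun y _ => ?_
    rw [← Finset.sum_mul]
    rfl
  have e2 : ∑ x, q x * ∑ y, V x y * Real.log (V x y / Q y) = mutualInfo q V +
      ∑ y, outputDist q V y * Real.log (outputDist q V y / Q y) := by
    rw [e, mutualInfo, ← Finset.sum_add_distrib]
    refine Finset.sum_congr rfl fun x _ => ?_
    rw [← Finset.sum_add_distrib, Finset.mul_sum]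
    refine Finset.sum_congr rfl fun y _ => ?_
    by_cases hx : q x = 0
    · simp [hx]
    by_cases hv : V x y = 0
    · simp [hv]
    have hn : outputDist q V y ≠ 0 := fun h =>
      hv (eq_zero_of_outputDist_eq_zero hq.1 hV hx h)
    rw [Real.log_div hv (hQ.2 y).ne', Real.log_div hv hn, Real.log_div hn (hQ.2 y).ne']
    ring
  linarith

/-- The optimal `Q` is the output distribution, which may have zeros; its mixture with the uniform
distribution dominates `1 - ε` times it, whence the error term. -/
theorem sum_mixUniform_le {V : X → Y → ℝ} {ε : ℝ} (hq : q ∈ stdSimplex ℝ X)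
    (hV : V ∈ channels X Y) (hε : ε ∈ Set.Ioo (0 : ℝ) 1) :
    ∑ x, q x * ∑ y, V x y * Real.log (V x y / mixUniform ε (outputDist q V) y) ≤
      mutualInfo q V - Real.log (1 - ε) := by
  have ho := outputDist_mem_stdSimplex hq hV
  have hmix := mixUniform_mem ho hε
  have h1 : 0 < 1 - ε := by linarith [hε.2]
  have e : Real.log (1 - ε) = ∑ x, ∑ y, q x * V x y * Real.log (1 - ε) := by
    simp_rw [← Finset.sum_mul, ← Finset.mul_sum, (hV _).2, mul_one, hq.2, one_mul]
  rw [e, mutualInfo, ← Finset.sum_sub_distrib]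
  refine Finset.sum_le_sum fun x _ => ?_
  rw [← Finset.sum_sub_distrib, Finset.mul_sum]
  refine Finset.sum_le_sum fun y _ => ?_
  rcases (hq.1 x).eq_or_lt with hx | hx
  · simp [← hx]
  rcases (mem_channels_nonneg hV x y).eq_or_lt with hv | hv
  · simp [← hv]
  have hn : 0 < outputDist q V y := (ho.1 y).lt_of_ne fun h =>
      hv.ne' (eq_zero_of_outputDist_eq_zero hq.1 hV hx.ne' h.symm)
  rw [← mul_sub, ← Real.log_div (by positivity) h1.ne', div_div, mul_assoc]
  refine mul_le_mul_of_nonneg_left (mul_le_mul_of_nonneg_left ?_ hv.le) hx.le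
  refine Real.log_le_log (div_pos hv (hmix.2 y)) ?_
  refine div_le_div_of_nonneg_left hv.le (by positivity) ?_
  rw [mul_comm]
  exact le_mixUniform hε y

theorem iInf_dominatedChannels_eq (hW : W ∈ channels X Y) (hq : q ∈ stdSimplex ℝ X) (R : ℝ)
    {ρ : ℝ} (hρ : 0 ≤ ρ) :
    (⨅ V ∈ dominatedChannels W q,
      ((relEntropyReal V W q + ρ * (mutualInfo q V - R) : ℝ) : EReal)) =
    tiltedExponent W R ρ q := by
  have key : ∀ (V : X → Y → ℝ) (Q : Y → ℝ), ∑ x, q x * (∑ y, V x y * Real.log (V x y / W x y) +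
      ρ * ∑ y, V x y * Real.log (V x y / Q y)) = relEntropyReal V W q +
      ρ * ∑ x, q x * ∑ y, V x y * Real.log (V x y / Q y) := fun V Q => by
    rw [relEntropyReal, Finset.mul_sum, ← Finset.sum_add_distrib]
    exact Finset.sum_congr rfl fun x _ => by ring
  refine le_antisymm (le_iInf₂ fun Q hQ => ?_) (le_iInf₂ fun V hV => ?_)
  · have hV := tiltedChannel_mem (ρ := ρ) hW hQ.2
    refine iInf₂_le_of_le (tiltedChannel W ρ Q)
      ⟨hV, fun x y _ h => tiltedChannel_eq_zero hρ h⟩ (EReal.coe_le_coe_iff.2 ?_)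
    rw [← Finset.sum_congr rfl fun x _ => congrArg (q x * ·) (tiltedCost_eq hW hQ.2 hρ x), key]
    have := mul_le_mul_of_nonneg_left (mutualInfo_le_sum hq hV hQ) hρ
    linarith
  · refine le_coe_of_forall_le_sub_mul_log (t := ρ) fun ε hε => ?_
    have hmix := mixUniform_mem (outputDist_mem_stdSimplex hq hV.1) hε
    refine iInf₂_le_of_le _ hmix (EReal.coe_le_coe_iff.2 ?_)
    have h : ∑ x, q x * tiltedCost W ρ (mixUniform ε (outputDist q V)) x ≤
        ∑ x, q x * (∑ y, V x y * Real.log (V x y / W x y) +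
          ρ * ∑ y, V x y * Real.log (V x y / mixUniform ε (outputDist q V) y)) := by
      refine Finset.sum_le_sum fun x _ => ?_
      by_cases hx : q x = 0
      · simp [hx]
      · exact mul_le_mul_of_nonneg_left
          (tiltedCost_le (hW x).1 (hV.1 x) (fun y => hV.2 x y hx) hmix.2 hρ) (hq.1 x)
    rw [key] at h
    have := mul_le_mul_of_nonneg_left (sum_mixUniform_le hq hV.1 hε) hρ
    linarith

theorem ckInner_eq_iSup (hW : W ∈ channels X Y) (R : ℝ) (hq : q ∈ stdSimplex ℝ X) :
    ckInner W R q = ⨆ ρ ∈ Set.Icc (0 : ℝ) 1, tiltedExponent W R ρ q := by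
  rw [ckInner_eq_iSup_iInf hW R hq.1]
  exact biSup_congr fun ρ hρ => iInf_dominatedChannels_eq hW hq R hρ.1

/-- An infimum of functions jointly continuous in `(ρ, q)`. -/
theorem upperSemicontinuousOn_tiltedExponent (hW : W ∈ channels X Y) (R : ℝ) (C : Set (X → ℝ)) :
    UpperSemicontinuousOn (fun z : ℝ × (X → ℝ) => tiltedExponent W R z.1 z.2)
      (Set.Icc 0 1 ×ˢ C) := by
  unfold tiltedExponent
  refine upperSemicontinuousOn_biInf fun Q hQ => ContinuousOn.upperSemicontinuousOn ?_
  refine continuous_coe_real_ereal.comp_continuousOn (ContinuousOn.add (by fun_prop) ?_)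
  refine continuousOn_finsetSum _ fun x _ => ContinuousOn.mul (by fun_prop) ?_
  exact (continuousOn_tiltedCost hW hQ.2 x).comp continuousOn_fst fun z hz => hz.1

end

/-! ### Hölder's inequality and optimality conditions for Gallager's sum -/

section

variable {X Y : Type*} [Fintype X] [Fintype Y] {A : X → Y → ℝ} {ρ : ℝ}

/-- The sum `∑ y, (∑ x, p(x) A(x, y))^(1+ρ)` inside Gallager's function. -/
noncomputable def gallagerSum {X Y : Type*} [Fintype X] [Fintype Y] (A : X → Y → ℝ) (ρ : ℝ)
    (p : X → ℝ) : ℝ :=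
  ∑ y, (∑ x, p x * A x y) ^ (1 + ρ)

theorem gallagerSum_pos (hA : ∀ x y, 0 ≤ A x y) (hA' : ∀ x, ∃ y, A x y ≠ 0) {p : X → ℝ}
    (hp : p ∈ stdSimplex ℝ X) : 0 < gallagerSum A ρ p := by
  have hb : ∀ y, 0 ≤ ∑ x, p x * A x y := fun y =>
    Finset.sum_nonneg fun x _ => mul_nonneg (hp.1 x) (hA x y)
  obtain ⟨x, hx⟩ : ∃ x, p x ≠ 0 := by
    by_contra! h
    simpa [h] using hp.2
  obtain ⟨y, hy⟩ := hA' x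
  refine Finset.sum_pos' (fun y _ => Real.rpow_nonneg (hb y) _) ⟨y, Finset.mem_univ y, ?_⟩
  refine Real.rpow_pos_of_pos (Finset.sum_pos' (fun x _ => mul_nonneg (hp.1 x) (hA x y))
    ⟨x, Finset.mem_univ x, ?_⟩) _
  exact mul_pos ((hp.1 x).lt_of_ne hx.symm) ((hA x y).lt_of_ne hy.symm)

theorem continuous_gallagerSum (hρ : 0 ≤ ρ) : Continuous (gallagerSum A ρ) := by
  unfold gallagerSum
  refine continuous_finsetSum _ fun y _ => ?_
  exact (Real.continuous_rpow_const (by positivity)).comp (by fun_prop)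

/-- Hölder's inequality for the tilted sums. -/
theorem sum_mul_sum_rpow_le (hA : ∀ x y, 0 ≤ A x y) {p : X → ℝ} (hp : p ∈ stdSimplex ℝ X)
    {Q : Y → ℝ} (hQ : Q ∈ stdSimplex ℝ Y) (hρ : 0 ≤ ρ) :
    ∑ x, p x * ∑ y, A x y * Q y ^ (ρ / (1 + ρ)) ≤ gallagerSum A ρ p ^ (1 / (1 + ρ)) := by
  have hb : ∀ y, 0 ≤ ∑ x, p x * A x y := fun y =>
    Finset.sum_nonneg fun x _ => mul_nonneg (hp.1 x) (hA x y)
  have e : ∑ x, p x * ∑ y, A x y * Q y ^ (ρ / (1 + ρ)) =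
      ∑ y, (∑ x, p x * A x y) * Q y ^ (ρ / (1 + ρ)) := by
    simp_rw [Finset.mul_sum, Finset.sum_mul]
    rw [Finset.sum_comm]
    simp_rw [mul_assoc]
  rw [e]
  -- The conjugate exponent `(1 + ρ) / ρ` degenerates at `ρ = 0`.
  rcases hρ.eq_or_lt with rfl | hρ
  · simp [gallagerSum]
  · have hpq : (1 + ρ).HolderConjugate ((1 + ρ) / ρ) := by
      rw [Real.holderConjugate_iff]
      refine ⟨by linarith, ?_⟩
      field_simp
    have h := Real.inner_le_Lp_mul_Lq_of_nonneg Finset.univ hpq (fun y _ => hb y)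
      (fun y _ => Real.rpow_nonneg (hQ.1 y) (ρ / (1 + ρ)))
    have e2 : ∑ y, (Q y ^ (ρ / (1 + ρ))) ^ ((1 + ρ) / ρ) = 1 := by
      refine (Finset.sum_congr rfl fun y _ => ?_).trans hQ.2
      rw [← Real.rpow_mul (hQ.1 y), div_mul_div_cancel₀ (show 1 + ρ ≠ 0 by positivity), div_self hρ.ne',
        Real.rpow_one]
    rw [e2, Real.one_rpow, mul_one] at h
    exact h

/-- First-order optimality condition for a minimizer of `gallagerSum`. -/
theorem gallagerSum_le_of_isMinOn {p : X → ℝ} (hp : p ∈ stdSimplex ℝ X)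
    (hmin : IsMinOn (gallagerSum A ρ) (stdSimplex ℝ X) p) (hA : ∀ x y, 0 ≤ A x y) (hρ : 0 ≤ ρ)
    (x : X) : gallagerSum A ρ p ≤ ∑ y, A x y * (∑ x', p x' * A x' y) ^ ρ := by
  classical
  set b : Y → ℝ := fun y => ∑ x', p x' * A x' y with hbdef
  have hb : ∀ y, 0 ≤ b y := fun y =>
    Finset.sum_nonneg fun x _ => mul_nonneg (hp.1 x) (hA x y)
  -- Restriction to the segment from `p` to the vertex at `x`; minimality forces a nonnegative right
  -- derivative at `0`.
  let g : ℝ → ℝ := fun t => ∑ y, (b y + t * (A x y - b y)) ^ (1 + ρ)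
  have hg : ∀ t ∈ Set.Ioc (0 : ℝ) 1, g 0 ≤ g t := fun t ht => by
    have hmem : (1 - t) • p + t • Pi.single x (1 : ℝ) ∈ stdSimplex ℝ X :=
      convex_stdSimplex ℝ X hp (single_mem_stdSimplex ℝ x) (by linarith [ht.2]) ht.1.le (by ring)
    have h0 : g 0 = gallagerSum A ρ p := by simp [g, gallagerSum, hbdef]
    have h1 : g t = gallagerSum A ρ ((1 - t) • p + t • Pi.single x (1 : ℝ)) := by
      refine Finset.sum_congr rfl fun y _ => ?_
      congr 1
      simp only [Pi.add_apply, Pi.smul_apply, smul_eq_mul, add_mul, Finset.sum_add_distrib,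
        mul_assoc, ← Finset.mul_sum, Pi.single_apply, ite_mul, one_mul, zero_mul,
        Finset.sum_ite_eq', Finset.mem_univ, if_true, hbdef]
      ring
    rw [h0, h1]
    exact hmin hmem
  have hd : HasDerivAt g (∑ y, (A x y - b y) * (1 + ρ) * b y ^ ρ) 0 := by
    refine HasDerivAt.fun_sum fun y _ => ?_
    have h := ((((hasDerivAt_id (0 : ℝ)).mul_const (A x y - b y)).const_add (b y)).rpow_const
      (p := 1 + ρ) (Or.inr (by linarith)))
    simpa using h
  have hs : 0 ≤ ∑ y, (A x y - b y) * (1 + ρ) * b y ^ ρ := by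
    have ht := (hasDerivWithinAt_iff_tendsto_slope' (s := Set.Ioi 0) (by simp)).1
      (hd.hasDerivWithinAt (s := Set.Ioi 0))
    refine ge_of_tendsto ht ?_
    filter_upwards [Ioc_mem_nhdsGT (show (0 : ℝ) < 1 by norm_num)] with t ht
    rw [slope_def_field, sub_zero]
    exact div_nonneg (sub_nonneg.2 (hg t ht)) ht.1.le
  have e : ∑ y, (A x y - b y) * (1 + ρ) * b y ^ ρ =
      (1 + ρ) * (∑ y, A x y * b y ^ ρ - gallagerSum A ρ p) := by
    rw [gallagerSum, ← Finset.sum_sub_distrib, Finset.mul_sum]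
    refine Finset.sum_congr rfl fun y _ => ?_
    rw [Real.rpow_add_of_nonneg (hb y) zero_le_one hρ, Real.rpow_one]
    ring
  rw [e] at hs
  linarith [nonneg_of_mul_nonneg_right hs (by positivity)]

/-- A minimizer of `gallagerSum` gives an output distribution with large tilted sums. -/
theorem exists_stdSimplex_le_sum_rpow {p : X → ℝ} (hp : p ∈ stdSimplex ℝ X)
    (hmin : IsMinOn (gallagerSum A ρ) (stdSimplex ℝ X) p) (hA : ∀ x y, 0 ≤ A x y)
    (hA' : ∀ x, ∃ y, A x y ≠ 0) (hρ : 0 ≤ ρ) :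
    ∃ Q ∈ stdSimplex ℝ Y, ∀ x,
      gallagerSum A ρ p ^ (1 / (1 + ρ)) ≤ ∑ y, A x y * Q y ^ (ρ / (1 + ρ)) := by
  have hS : 0 < gallagerSum A ρ p := gallagerSum_pos hA hA' hp
  have hb : ∀ y, 0 ≤ ∑ x, p x * A x y := fun y =>
    Finset.sum_nonneg fun x _ => mul_nonneg (hp.1 x) (hA x y)
  -- The equality case in Hölder's inequality.
  refine ⟨fun y => (∑ x, p x * A x y) ^ (1 + ρ) / gallagerSum A ρ p,
    ⟨fun y => div_nonneg (Real.rpow_nonneg (hb y) _) hS.le, ?_⟩, fun x => ?_⟩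
  · rw [← Finset.sum_div]
    exact div_self hS.ne'
  · have e : ∀ y, A x y * ((∑ x, p x * A x y) ^ (1 + ρ) / gallagerSum A ρ p) ^ (ρ / (1 + ρ)) =
        A x y * (∑ x, p x * A x y) ^ ρ / gallagerSum A ρ p ^ (ρ / (1 + ρ)) := fun y => by
      rw [Real.div_rpow (Real.rpow_nonneg (hb y) _) hS.le, ← Real.rpow_mul (hb y),
        mul_div_cancel₀ _ (by positivity), mul_div_assoc]
    rw [Finset.sum_congr rfl fun y _ => e y, ← Finset.sum_div,
      le_div_iff₀ (Real.rpow_pos_of_pos hS _), ← Real.rpow_add hS, ← add_div,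
      div_self (by positivity), Real.rpow_one]
    exact gallagerSum_le_of_isMinOn hp hmin hA hρ x

end

/-! ### Tilted costs with a multiplier, and their convexity in the output distribution -/

section

variable {X Y : Type*} [Fintype Y] {W : X → Y → ℝ} {c : X → ℝ} {ρ ν : ℝ}

/-- The matrix of Gallager's function. -/
noncomputable def gallagerMatrix {X Y : Type*} (W : X → Y → ℝ) (c : X → ℝ) (ρ ν : ℝ) (x : X)
    (y : Y) : ℝ :=
  (W x y * Real.exp (ρ * ν * c x)) ^ (1 / (1 + ρ))

theorem gallagerMatrix_nonneg (hW : W ∈ channels X Y) (x : X) (y : Y) :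
    0 ≤ gallagerMatrix W c ρ ν x y :=
  Real.rpow_nonneg (mul_nonneg ((hW x).1 y) (Real.exp_pos _).le) _

theorem exists_gallagerMatrix_ne_zero (hW : W ∈ channels X Y) (x : X) :
    ∃ y, gallagerMatrix W c ρ ν x y ≠ 0 := by
  obtain ⟨y, hy⟩ : ∃ y, W x y ≠ 0 := by
    by_contra! h
    have := (hW x).2
    simp [h] at this
  exact ⟨y, (Real.rpow_pos_of_pos (mul_pos (((hW x).1 y).lt_of_ne hy.symm)
    (Real.exp_pos _)) _).ne'⟩

theorem sum_gallagerMatrix_pos (hW : W ∈ channels X Y) {Q : Y → ℝ} (hQ : ∀ y, 0 < Q y) (x : X) :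
    0 < ∑ y, gallagerMatrix W c ρ ν x y * Q y ^ (ρ / (1 + ρ)) := by
  obtain ⟨y, hy⟩ := exists_gallagerMatrix_ne_zero (c := c) (ρ := ρ) (ν := ν) hW x
  refine Finset.sum_pos' (fun y _ => mul_nonneg (gallagerMatrix_nonneg hW x y)
    (Real.rpow_nonneg (hQ y).le _)) ⟨y, Finset.mem_univ y, mul_pos
      ((gallagerMatrix_nonneg hW x y).lt_of_ne hy.symm) (Real.rpow_pos_of_pos (hQ y) _)⟩

/-- The factor `exp (ρ ν c(x) / (1 + ρ))` is constant in `y` and leaves the sum; the prefactor `-(1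
+ ρ)` turns it into the linear penalty. -/
theorem tiltedCost_sub (hW : W ∈ channels X Y) {Q : Y → ℝ} (hQ : ∀ y, 0 < Q y) (hρ : 0 ≤ ρ)
    (x : X) : tiltedCost W ρ Q x - ρ * ν * c x =
      -(1 + ρ) * Real.log (∑ y, gallagerMatrix W c ρ ν x y * Q y ^ (ρ / (1 + ρ))) := by
  have e : ∑ y, gallagerMatrix W c ρ ν x y * Q y ^ (ρ / (1 + ρ)) =
      Real.exp (ρ * ν * c x * (1 / (1 + ρ))) * tiltedSum W ρ Q x := by
    rw [tiltedSum, Finset.mul_sum]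
    refine Finset.sum_congr rfl fun y _ => ?_
    rw [gallagerMatrix, Real.mul_rpow ((hW x).1 y) (Real.exp_pos _).le, ← Real.exp_mul]
    ring
  rw [e, Real.log_mul (Real.exp_pos _).ne' (tiltedSum_pos hW hQ x).ne', Real.log_exp, tiltedCost]
  have : 1 + ρ ≠ 0 := by positivity
  field_simp
  ring

theorem positiveSimplex_nonempty [Nonempty X] (hW : W ∈ channels X Y) :
    (positiveSimplex Y).Nonempty :=
  ⟨_, mixUniform_mem (ε := 1 / 2) (hW (Classical.arbitrary X)) (by norm_num)⟩

theorem convex_positiveSimplex : Convex ℝ (positiveSimplex Y) := fun _ h₁ _ h₂ _ _ ha hb hab =>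
  ⟨convex_stdSimplex ℝ Y h₁.1 h₂.1 ha hb hab,
    fun y => convex_Ioi (0 : ℝ) (h₁.2 y) (h₂.2 y) ha hb hab⟩

/-- Powers with exponent `ρ / (1 + ρ) ∈ [0, 1]` are concave, and an increasing concave logarithm
keeps the sum concave; the negative prefactor reverses this. -/
theorem convexOn_tiltedCost (hW : W ∈ channels X Y) (hρ : 0 ≤ ρ) (x : X) :
    ConvexOn ℝ (positiveSimplex Y) fun Q => tiltedCost W ρ Q x := by
  have hs0 : 0 ≤ ρ / (1 + ρ) := by positivity
  have hs1 : ρ / (1 + ρ) ≤ 1 := by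
    rw [div_le_one (by positivity)]
    linarith
  refine ⟨convex_positiveSimplex, fun Q₁ h₁ Q₂ h₂ a b ha hb hab => ?_⟩
  have t₁ := tiltedSum_pos (ρ := ρ) hW h₁.2 x
  have t₂ := tiltedSum_pos (ρ := ρ) hW h₂.2 x
  have hconc : a * tiltedSum W ρ Q₁ x + b * tiltedSum W ρ Q₂ x ≤
      tiltedSum W ρ (a • Q₁ + b • Q₂) x := by
    simp only [tiltedSum, Finset.mul_sum, ← Finset.sum_add_distrib]
    refine Finset.sum_le_sum fun y _ => ?_
    have h := (Real.concaveOn_rpow hs0 hs1).2 (h₁.2 y).le (h₂.2 y).le ha hb hab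
    have h' := mul_le_mul_of_nonneg_left h (Real.rpow_nonneg ((hW x).1 y) (1 / (1 + ρ)))
    simp only [smul_eq_mul] at h'
    simp only [Pi.add_apply, Pi.smul_apply, smul_eq_mul]
    linarith
  have hpos : 0 < a * tiltedSum W ρ Q₁ x + b * tiltedSum W ρ Q₂ x :=
    convex_Ioi (0 : ℝ) t₁ t₂ ha hb hab
  have hlog := strictConcaveOn_log_Ioi.concaveOn.2 t₁ t₂ ha hb hab
  have h := mul_le_mul_of_nonneg_left (hlog.trans (Real.log_le_log hpos hconc))
    (show 0 ≤ 1 + ρ by positivity)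
  simp only [smul_eq_mul] at h
  simp only [tiltedCost, smul_eq_mul]
  linarith

theorem continuousOn_tiltedCost_right (hW : W ∈ channels X Y) (hρ : 0 ≤ ρ) (x : X) :
    ContinuousOn (fun Q => tiltedCost W ρ Q x) (positiveSimplex Y) := by
  refine continuousOn_const.mul (ContinuousOn.log (Continuous.continuousOn ?_)
    fun Q hQ => (tiltedSum_pos hW hQ.2 x).ne')
  refine continuous_finsetSum _ fun y _ => continuous_const.mul ?_
  exact (Real.continuous_rpow_const (by positivity)).comp (by fun_prop)

end

/-! ### Lagrange duality for the cost constraint -/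

section

variable {X Y : Type*} [Fintype X] [Fintype Y] {W : X → Y → ℝ} {c : X → ℝ} {R Γ ρ ν : ℝ}

theorem gallagerE0_eq (p : X → ℝ) :
    gallagerE0 W c ρ ν p = -Real.log (gallagerSum (gallagerMatrix W c ρ ν) ρ p) := rfl

theorem continuousOn_gallagerObjective (hW : W ∈ channels X Y) (hρ : 0 ≤ ρ) :
    ContinuousOn (gallagerObjective W c R Γ ρ ν) (stdSimplex ℝ X) := by
  refine continuousOn_const.add (ContinuousOn.neg (ContinuousOn.log ?_ fun p hp => ?_))
  · exact (continuous_gallagerSum (A := gallagerMatrix W c ρ ν) hρ).continuousOn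
  · exact (gallagerSum_pos (gallagerMatrix_nonneg hW) (exists_gallagerMatrix_ne_zero hW) hp).ne'

theorem exists_isMaxOn_gallagerObjective [Nonempty X] (hW : W ∈ channels X Y) (hρ : 0 ≤ ρ) :
    ∃ p ∈ stdSimplex ℝ X, IsMaxOn (gallagerObjective W c R Γ ρ ν) (stdSimplex ℝ X) p := by
  classical
  exact (isCompact_stdSimplex ℝ X).exists_isMaxOn
    ⟨_, single_mem_stdSimplex ℝ (Classical.arbitrary X)⟩ (continuousOn_gallagerObjective hW hρ)

theorem isMinOn_gallagerSum {p : X → ℝ} (hW : W ∈ channels X Y) (hp : p ∈ stdSimplex ℝ X)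
    (hmax : IsMaxOn (gallagerObjective W c R Γ ρ ν) (stdSimplex ℝ X) p) :
    IsMinOn (gallagerSum (gallagerMatrix W c ρ ν) ρ) (stdSimplex ℝ X) p := fun p' hp' => by
  have h : gallagerObjective W c R Γ ρ ν p' ≤ gallagerObjective W c R Γ ρ ν p := hmax hp'
  simp only [gallagerObjective, gallagerE0_eq, add_le_add_iff_left, neg_le_neg_iff] at h
  have hA := gallagerMatrix_nonneg (c := c) (ρ := ρ) (ν := ν) hW
  have hA' := exists_gallagerMatrix_ne_zero (c := c) (ρ := ρ) (ν := ν) hW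
  exact (Real.log_le_log_iff (gallagerSum_pos hA hA' hp) (gallagerSum_pos hA hA' hp')).1 h

/-- The Lagrangian of the cost-constrained problem, with the output distribution as a second dual
variable. -/
noncomputable def lagrangian {X Y : Type*} [Fintype X] [Fintype Y] (W : X → Y → ℝ) (c : X → ℝ)
    (R Γ ρ : ℝ) (q : X → ℝ) (z : ℝ × (Y → ℝ)) : ℝ :=
  -ρ * R + ∑ x, q x * tiltedCost W ρ z.2 x + ρ * z.1 * (Γ - ∑ x, q x * c x)

theorem lagrangian_eq {q : X → ℝ} {Q : Y → ℝ} :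
    lagrangian W c R Γ ρ q (ν, Q) =
      -ρ * R + ρ * ν * Γ + ∑ x, q x * (tiltedCost W ρ Q x - ρ * ν * c x) := by
  simp only [lagrangian, mul_sub, Finset.sum_sub_distrib]
  have : ∑ x, q x * (ρ * ν * c x) = ρ * ν * ∑ x, q x * c x := by
    rw [Finset.mul_sum]
    exact Finset.sum_congr rfl fun x _ => by ring
  rw [this]
  ring

/-- Hölder bounds the `p`-average of the tilted sums, so some letter obeys the same bound. -/
theorem gallagerE0_le {p : X → ℝ} {Q : Y → ℝ} (hW : W ∈ channels X Y) (hp : p ∈ stdSimplex ℝ X)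
    (hQ : Q ∈ positiveSimplex Y) (hρ : 0 ≤ ρ) :
    ∃ x, gallagerE0 W c ρ ν p ≤ tiltedCost W ρ Q x - ρ * ν * c x := by
  have hA := gallagerMatrix_nonneg (c := c) (ρ := ρ) (ν := ν) hW
  have hA' := exists_gallagerMatrix_ne_zero (c := c) (ρ := ρ) (ν := ν) hW
  set S := gallagerSum (gallagerMatrix W c ρ ν) ρ p with hSdef
  have hS : 0 < S := gallagerSum_pos hA hA' hp
  have hH := sum_mul_sum_rpow_le hA hp hQ.1 hρ
  obtain ⟨x, hx⟩ : ∃ x, ∑ y, gallagerMatrix W c ρ ν x y * Q y ^ (ρ / (1 + ρ)) ≤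
      S ^ (1 / (1 + ρ)) := by
    by_contra! h
    obtain ⟨x₀, hx₀⟩ : ∃ x, p x ≠ 0 := by
      by_contra! h
      simpa [h] using hp.2
    have : ∑ x, p x * S ^ (1 / (1 + ρ)) <
        ∑ x, p x * ∑ y, gallagerMatrix W c ρ ν x y * Q y ^ (ρ / (1 + ρ)) :=
      Finset.sum_lt_sum (fun x _ => mul_le_mul_of_nonneg_left (h x).le (hp.1 x))
        ⟨x₀, Finset.mem_univ _, mul_lt_mul_of_pos_left (h x₀) ((hp.1 x₀).lt_of_ne hx₀.symm)⟩
    rw [← Finset.sum_mul, hp.2, one_mul] at this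
    exact absurd hH this.not_ge
  refine ⟨x, ?_⟩
  rw [tiltedCost_sub hW hQ.2 hρ, gallagerE0_eq, ← hSdef]
  have h := Real.log_le_log (sum_gallagerMatrix_pos hW hQ.2 x) hx
  rw [Real.log_rpow hS] at h
  have h2 := mul_le_mul_of_nonneg_left h (show 0 ≤ 1 + ρ by positivity)
  rw [← mul_assoc, mul_one_div_cancel (by positivity), one_mul] at h2
  linarith

/-- The Hölder-optimal `Q` bounds all letters at once but may have zeros; mixing makes it positive
at the price of the logarithmic term. -/
theorem exists_tiltedCost_le {p : X → ℝ} {ε : ℝ} (hW : W ∈ channels X Y)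
    (hp : p ∈ stdSimplex ℝ X)
    (hmin : IsMinOn (gallagerSum (gallagerMatrix W c ρ ν) ρ) (stdSimplex ℝ X) p)
    (hρ : 0 ≤ ρ) (hε : ε ∈ Set.Ioo (0 : ℝ) 1) :
    ∃ Q ∈ positiveSimplex Y, ∀ x, tiltedCost W ρ Q x - ρ * ν * c x ≤
      gallagerE0 W c ρ ν p - ρ * Real.log (1 - ε) := by
  have hA := gallagerMatrix_nonneg (c := c) (ρ := ρ) (ν := ν) hW
  have hA' := exists_gallagerMatrix_ne_zero (c := c) (ρ := ρ) (ν := ν) hW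
  have hS := gallagerSum_pos (ρ := ρ) hA hA' hp
  obtain ⟨Q, hQ, hle⟩ := exists_stdSimplex_le_sum_rpow hp hmin hA hA' hρ
  have h1 : 0 < 1 - ε := by linarith [hε.2]
  have hmix := mixUniform_mem hQ hε
  refine ⟨_, hmix, fun x => ?_⟩
  rw [tiltedCost_sub hW hmix.2 hρ, gallagerE0_eq]
  have h : (1 - ε) ^ (ρ / (1 + ρ)) *
      gallagerSum (gallagerMatrix W c ρ ν) ρ p ^ (1 / (1 + ρ)) ≤
      ∑ y, gallagerMatrix W c ρ ν x y * mixUniform ε Q y ^ (ρ / (1 + ρ)) := by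
    refine (mul_le_mul_of_nonneg_left (hle x) (Real.rpow_nonneg h1.le _)).trans ?_
    rw [Finset.mul_sum]
    refine Finset.sum_le_sum fun y _ => ?_
    rw [mul_left_comm, ← Real.mul_rpow h1.le (hQ.1 y)]
    refine mul_le_mul_of_nonneg_left ?_ (hA x y)
    exact Real.rpow_le_rpow (mul_nonneg h1.le (hQ.1 y)) (le_mixUniform hε y) (by positivity)
  have h := Real.log_le_log (by positivity) h
  rw [Real.log_mul (by positivity) (by positivity), Real.log_rpow h1, Real.log_rpow hS] at h
  have h2 := mul_le_mul_of_nonneg_left h (show 0 ≤ 1 + ρ by positivity)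
  have e : (1 + ρ) * (ρ / (1 + ρ) * Real.log (1 - ε) + 1 / (1 + ρ) *
      Real.log (gallagerSum (gallagerMatrix W c ρ ν) ρ p)) = ρ * Real.log (1 - ε) +
      Real.log (gallagerSum (gallagerMatrix W c ρ ν) ρ p) := by
    have : 1 + ρ ≠ 0 := by positivity
    field_simp
  rw [e] at h2
  linarith

/-- For a fixed multiplier, the maximum of Gallager's functional is a minimax value of the
Lagrangian. -/
theorem iSup_gallagerObjective_eq [Nonempty X] (hW : W ∈ channels X Y) (hρ : 0 ≤ ρ) :
    (⨆ p ∈ stdSimplex ℝ X, (gallagerObjective W c R Γ ρ ν p : EReal)) =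
      ⨅ Q ∈ positiveSimplex Y, ⨆ q ∈ stdSimplex ℝ X, (lagrangian W c R Γ ρ q (ν, Q) : EReal) := by
  classical
  refine le_antisymm (iSup₂_le fun p hp => le_iInf₂ fun Q hQ => ?_) ?_
  · obtain ⟨x, hx⟩ := gallagerE0_le (c := c) (ν := ν) hW hp hQ hρ
    refine le_iSup₂_of_le _ (single_mem_stdSimplex ℝ x) (EReal.coe_le_coe_iff.2 ?_)
    rw [lagrangian_eq, gallagerObjective]
    simpa [Pi.single_apply] using hx
  · obtain ⟨p, hp, hmax⟩ := exists_isMaxOn_gallagerObjective (c := c) (R := R) (Γ := Γ) (ν := ν)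
      hW hρ
    refine le_iSup₂_of_le p hp (le_coe_of_forall_le_sub_mul_log (t := ρ) fun ε hε => ?_)
    obtain ⟨Q, hQ, hle⟩ := exists_tiltedCost_le hW hp (isMinOn_gallagerSum hW hp hmax) hρ hε
    refine iInf₂_le_of_le Q hQ (iSup₂_le fun q hq => EReal.coe_le_coe_iff.2 ?_)
    have h : ∑ x, q x * (tiltedCost W ρ Q x - ρ * ν * c x) ≤
        ∑ x, q x * (gallagerE0 W c ρ ν p - ρ * Real.log (1 - ε)) :=
      Finset.sum_le_sum fun x _ => mul_le_mul_of_nonneg_left (hle x) (hq.1 x)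
    rw [← Finset.sum_mul, hq.2, one_mul] at h
    rw [lagrangian_eq, gallagerObjective]
    linarith

theorem convexOn_lagrangian (hW : W ∈ channels X Y) (hρ : 0 ≤ ρ) {q : X → ℝ}
    (hq : ∀ x, 0 ≤ q x) :
    ConvexOn ℝ (Set.Ici (0 : ℝ) ×ˢ positiveSimplex Y) (lagrangian W c R Γ ρ q) := by
  refine ⟨(convex_Ici 0).prod convex_positiveSimplex, fun z₁ h₁ z₂ h₂ a b ha hb hab => ?_⟩
  · have h : ∑ x, q x * tiltedCost W ρ (a • z₁ + b • z₂).2 x ≤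
        a * ∑ x, q x * tiltedCost W ρ z₁.2 x + b * ∑ x, q x * tiltedCost W ρ z₂.2 x := by
      rw [Finset.mul_sum, Finset.mul_sum, ← Finset.sum_add_distrib]
      refine Finset.sum_le_sum fun x _ => ?_
      have := mul_le_mul_of_nonneg_left
        ((convexOn_tiltedCost hW hρ x).2 h₁.2 h₂.2 ha hb hab) (hq x)
      simp only [smul_eq_mul] at this
      simp only [Prod.snd_add, Prod.smul_snd]
      linarith
    simp only [lagrangian, smul_eq_mul]
    simp only [Prod.fst_add, Prod.smul_fst, smul_eq_mul]
    have e : -ρ * R = a * (-ρ * R) + b * (-ρ * R) := by rw [← add_mul, hab, one_mul]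
    linarith

/-- Lagrange duality for the cost constraint. -/
theorem iSup_costConstrained_eq [Nonempty X] (hW : W ∈ channels X Y) (hρ : 0 < ρ) :
    (⨆ q ∈ costConstrained c Γ, tiltedExponent W R ρ q) =
      ⨆ q ∈ stdSimplex ℝ X, ⨅ z ∈ Set.Ici (0 : ℝ) ×ˢ positiveSimplex Y,
        (lagrangian W c R Γ ρ q z : EReal) := by
  refine le_antisymm (iSup₂_le fun q hq => le_iSup₂_of_le q hq.1 (le_iInf₂ fun z hz => ?_))
    (iSup₂_le fun q hq => ?_)
  · refine iInf₂_le_of_le z.2 hz.2 (EReal.coe_le_coe_iff.2 ?_)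
    have : 0 ≤ ρ * z.1 * (Γ - ∑ x, q x * c x) :=
      mul_nonneg (mul_nonneg hρ.le hz.1) (sub_nonneg.2 hq.2)
    rw [lagrangian]
    linarith
  · by_cases h : ∑ x, q x * c x ≤ Γ
    · refine le_iSup₂_of_le q ⟨hq, h⟩ (le_iInf₂ fun Q hQ => iInf₂_le_of_le (0, Q)
        ⟨Set.self_mem_Ici, hQ⟩ (EReal.coe_le_coe_iff.2 ?_))
      simp [lagrangian]
    · obtain ⟨Q, hQ⟩ := positiveSimplex_nonempty hW
      push Not at h
      have hδ : 0 < ρ * (∑ x, q x * c x - Γ) := mul_pos hρ (sub_pos.2 h)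
      refine le_of_eq_of_le (EReal.eq_bot_iff_forall_lt _ |>.2 fun M => ?_) bot_le
      set r := -ρ * R + ∑ x, q x * tiltedCost W ρ Q x with hr
      -- For an input violating the constraint, this multiplier makes the penalty at least `r - M +
      -- 1`, so the Lagrangian is at most `M - 1`.
      refine lt_of_le_of_lt (iInf₂_le (max 0 ((r - M + 1) / (ρ * (∑ x, q x * c x - Γ))), Q)
        ⟨Set.mem_Ici.2 (le_max_left _ _), hQ⟩) (EReal.coe_lt_coe_iff.2 ?_)
      have h1 := mul_le_mul_of_nonneg_right
        (le_max_right 0 ((r - M + 1) / (ρ * (∑ x, q x * c x - Γ)))) hδ.le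
      rw [div_mul_cancel₀ _ hδ.ne'] at h1
      rw [lagrangian, ← hr]
      linarith

theorem tiltedExponent_zero [Nonempty X] (hW : W ∈ channels X Y) (q : X → ℝ) :
    tiltedExponent W R 0 q = 0 := by
  have h : ∀ Q x, tiltedCost W 0 Q x = 0 := fun Q x => by
    simp [tiltedCost, tiltedSum, (hW x).2]
  simp only [tiltedExponent, h]
  simpa using biInf_const (positiveSimplex_nonempty hW)

theorem gallagerInner_zero [Nonempty X] (hW : W ∈ channels X Y) :
    gallagerInner W c R Γ 0 = 0 := by
  classical
  have h : ∀ ν, ∀ p ∈ stdSimplex ℝ X, (gallagerObjective W c R Γ 0 ν p : EReal) = 0 :=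
    fun ν p hp => by
      have : ∑ y, ∑ x, p x * W x y = 1 := (outputDist_mem_stdSimplex hp hW).2
      simp [gallagerObjective, gallagerE0, this]
  rw [gallagerInner]
  simp_rw [biSup_congr (h _)]
  rw [biSup_const ⟨_, single_mem_stdSimplex ℝ (Classical.arbitrary X)⟩,
    biInf_const ⟨0, Set.self_mem_Ici⟩]

theorem gallagerInner_eq_iSup [Nonempty X] (hW : W ∈ channels X Y)
    (hC : (costConstrained c Γ).Nonempty) (hρ : 0 ≤ ρ) :
    gallagerInner W c R Γ ρ = ⨆ q ∈ costConstrained c Γ, tiltedExponent W R ρ q := by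
  classical
  -- At `ρ = 0` the penalty `ρ ν` vanishes and cannot enforce the constraint, but both sides are
  -- zero.
  rcases hρ.eq_or_lt with rfl | hρ
  · rw [gallagerInner_zero hW]
    simp_rw [tiltedExponent_zero hW]
    rw [biSup_const hC]
  rw [iSup_costConstrained_eq hW hρ, iSup_iInf_eq_iInf_iSup_of_isCompact
    ⟨_, single_mem_stdSimplex ℝ (Classical.arbitrary X)⟩ (convex_stdSimplex ℝ X)
    (isCompact_stdSimplex ℝ X) ((convex_Ici 0).prod convex_positiveSimplex), biInf_prod, gallagerInner]
  · exact biInf_congr fun ν _ => iSup_gallagerObjective_eq hW hρ.le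
  · intro z _
    unfold lagrangian
    fun_prop
  · refine fun z _ => ⟨convex_stdSimplex ℝ X, fun q₁ _ q₂ _ a b _ _ hab => le_of_eq ?_⟩
    simp only [lagrangian, smul_eq_mul, Pi.add_apply, Pi.smul_apply, add_mul,
      Finset.sum_add_distrib, mul_assoc, ← Finset.mul_sum]
    linear_combination (-ρ * R + ρ * z.1 * Γ) * hab
  · intro q _
    unfold lagrangian
    refine ContinuousOn.add (continuousOn_const.add ?_) (by fun_prop)
    refine continuousOn_finsetSum _ fun x _ => continuousOn_const.mul ?_
    exact (continuousOn_tiltedCost_right hW hρ.le x).comp continuousOn_snd fun z hz => hz.2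
  · exact fun q hq => convexOn_lagrangian hW hρ.le hq.1

theorem isCompact_costConstrained : IsCompact (costConstrained c Γ) :=
  (isCompact_stdSimplex ℝ X).inter_right <|
    isClosed_le (f := fun q : X → ℝ => ∑ x, q x * c x) (by fun_prop) continuous_const

theorem costConstrained_nonempty (h : ∃ x, c x ≤ Γ) : (costConstrained c Γ).Nonempty := by
  classical
  obtain ⟨x, hx⟩ := h
  exact ⟨_, single_mem_stdSimplex ℝ x, by simpa [Pi.single_apply] using hx⟩

end

end ChannelExponent

/-! ### Attainment and equality of the exponents -/

theorem proposition4 {X Y : Type*} [Fintype X] [Fintype Y]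
    (W : X → Y → ℝ) (hW : W ∈ ChannelExponent.channels X Y)
    (c : X → ℝ) (hc : ∀ x, 0 ≤ c x)
    (R Γ : ℝ) (hR : 0 ≤ R) (hΓ : 0 ≤ Γ) (hΓmin : ∃ x, c x ≤ Γ) :
    -- the minimum and the maxima in the two definitions are attained
    (∀ q ∈ ChannelExponent.costConstrained c Γ, ∃ V ∈ ChannelExponent.channels X Y,
        IsMinOn (ChannelExponent.ckObjective W R q) (ChannelExponent.channels X Y) V) ∧
    (∃ q ∈ ChannelExponent.costConstrained c Γ,
        IsMaxOn (ChannelExponent.ckInner W R) (ChannelExponent.costConstrained c Γ) q) ∧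
    (∀ ρ ∈ Set.Icc (0 : ℝ) 1, ∀ ν ∈ Set.Ici (0 : ℝ), ∃ p ∈ stdSimplex ℝ X,
        IsMaxOn (ChannelExponent.gallagerObjective W c R Γ ρ ν) (stdSimplex ℝ X) p) ∧
    (∃ ρ ∈ Set.Icc (0 : ℝ) 1,
        IsMaxOn (ChannelExponent.gallagerInner W c R Γ) (Set.Icc (0 : ℝ) 1) ρ) ∧
    -- the two exponents agree
    ChannelExponent.csiszarKornerExponent W c R Γ = ChannelExponent.gallagerExponent W c R Γ := by
  have hX : Nonempty X := hΓmin.nonempty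
  have hC := ChannelExponent.costConstrained_nonempty hΓmin
  have hck : ∀ q ∈ ChannelExponent.costConstrained c Γ, ChannelExponent.ckInner W R q =
      ⨆ ρ ∈ Set.Icc (0 : ℝ) 1, ChannelExponent.tiltedExponent W R ρ q :=
    fun q hq => ChannelExponent.ckInner_eq_iSup hW R hq.1
  have hga : ∀ ρ ∈ Set.Icc (0 : ℝ) 1, ChannelExponent.gallagerInner W c R Γ ρ =
      ⨆ q ∈ ChannelExponent.costConstrained c Γ, ChannelExponent.tiltedExponent W R ρ q :=
    fun ρ hρ => ChannelExponent.gallagerInner_eq_iSup hW hC hρ.1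
  -- The two coordinates of one joint maximizer attain the outer maxima of the two exponents.
  obtain ⟨⟨ρ, q⟩, ⟨hρ, hq⟩, hmax⟩ := UpperSemicontinuousOn.exists_isMaxOn
    ((Set.nonempty_Icc.2 zero_le_one).prod hC)
    (isCompact_Icc.prod ChannelExponent.isCompact_costConstrained)
    (ChannelExponent.upperSemicontinuousOn_tiltedExponent hW R
      (ChannelExponent.costConstrained c Γ))
  have hle : ∀ ρ' ∈ Set.Icc (0 : ℝ) 1, ∀ q' ∈ ChannelExponent.costConstrained c Γ,
      ChannelExponent.tiltedExponent W R ρ' q' ≤ ChannelExponent.tiltedExponent W R ρ q :=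
    fun ρ' hρ' q' hq' => hmax (Set.mk_mem_prod hρ' hq')
  refine ⟨fun q hq => ChannelExponent.exists_isMinOn_ckObjective hW R hq.1.1,
    ⟨q, hq, fun q' hq' => ?_⟩,
    fun ρ hρ ν _ => ChannelExponent.exists_isMaxOn_gallagerObjective hW hρ.1,
    ⟨ρ, hρ, fun ρ' hρ' => ?_⟩, ?_⟩
  · rw [Set.mem_ofPred_eq, hck q hq, hck q' hq']
    exact iSup₂_le fun ρ' hρ' => (hle ρ' hρ' q' hq').trans (le_iSup₂_of_le ρ hρ le_rfl)
  · rw [Set.mem_ofPred_eq, hga ρ hρ, hga ρ' hρ']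
    exact iSup₂_le fun q' hq' => (hle ρ' hρ' q' hq').trans (le_iSup₂_of_le q hq le_rfl)
  · rw [ChannelExponent.csiszarKornerExponent, ChannelExponent.gallagerExponent, biSup_congr hck,
      biSup_congr hga]
    exact iSup₂_comm _
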